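/- Let $G$ be a finite group. A Carter subgroup of $G$ is a nilpotent subgroup $C \le G$ with $N_G(C) = C$. We say that $G$ has a Sylow tower if there is a series $1 = H_0 \le H_1 \le \dots \le H_n = G$ of normal subgroups of $G$ such that each factor $H_{i+1}/H_i$ is isomorphic to a Sylow subgroup of $G$; and $G$ is supersoluble if there is such a series of normal subgroups of $G$ in which each factor $H_{i+1}/H_i$ is cyclic. If $G$ has a Sylow tower, then for every Carter subgroup $C$ of $G$ and every subgroup $X \le C$, the number of Carter subgroups of $G$ that contain $X$ divides the index $(G:C)$. In particular, the same conclusion holds for every finite supersoluble group $G$. -/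

import Mathlib

/-- A Carter subgroup: a nilpotent self-normalising subgroup. -/
def IsCarterSubgroup {G : Type*} [Group G] (C : Subgroup G) : Prop :=
  Group.IsNilpotent C ∧ Subgroup.normalizer (C : Set G) = C

/-- The number of Carter subgroups of `G` that contain `X`. -/
noncomputable def carterCount {G : Type*} [Group G] (X : Subgroup G) : ℕ :=
  Nat.card {D : Subgroup G // IsCarterSubgroup D ∧ X ≤ D}

/-- A finite ascending series `1 = H 0 ≤ H 1 ≤ ⋯ ≤ H length = G` of normal subgroups of `G`.
The terms beyond `length` are all equal to `G`, since `H` is monotone. -/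
structure NormalSeries (G : Type*) [Group G] where
  length : ℕ
  term : ℕ → Subgroup G
  mono : Monotone term
  term_zero : term 0 = ⊥
  term_length : term length = ⊤
  normal : ∀ i, (term i).Normal

attribute [instance] NormalSeries.normal

/-- The factor group `H (i + 1) / H i` of a normal series. -/
abbrev NormalSeries.Factor {G : Type*} [Group G] (S : NormalSeries G) (i : ℕ) : Type _ :=
  S.term (i + 1) ⧸ (S.term i).subgroupOf (S.term (i + 1))

/-- `G` has a Sylow tower: a normal series each of whose factors is isomorphic to a Sylow
subgroup of `G`. -/
def HasSylowTower (G : Type*) [Group G] : Prop :=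
  ∃ S : NormalSeries G, ∀ i < S.length,
    ∃ p : ℕ, p.Prime ∧ ∃ P : Sylow p G, Nonempty (S.Factor i ≃* P)

/-- `G` is supersoluble: it has a normal series with cyclic factors. -/
def IsSupersoluble (G : Type*) [Group G] : Prop :=
  ∃ S : NormalSeries G, ∀ i < S.length, IsCyclic (S.Factor i)

/-
Let `f : G → L` be surjective with kernel a nilpotent Hall subgroup `N` of `G`. The Carter
subgroups of `G` are the subgroups `Q * C_N(Q)`, where `Q` has order prime to `|N|` and `f(Q)` is a
Carter subgroup of `L`, and such a `Q` is determined by `Q * C_N(Q)`. Given `X ≤ G`, choose `Y ≤ X`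
of order prime to `|N|` with `f(Y) = f(X)`, and put `Z = C_G(X ∩ N)`; then `X ≤ Q * C_N(Q)` if and
only if `Y ≤ Q ≤ Z`. Fix one such `Q`. If the Carter subgroups of `f(Z)` are conjugate, counting
all subgroups `S` of this kind along `S ↦ f(S)` gives

  `|{S | Y ≤ S ≤ Z}| = |{R Carter in L | f(Y) ≤ R ≤ f(Z)}| * (C_{N ∩ Z}(Y) : C_{N ∩ Z}(Q))`,

because the subgroups `S` lying over a fixed `R` are conjugate under `C_{N ∩ Z}(Y)` by the
Schur–Zassenhaus theorem. On the other hand `(G : Q * C_N(Q)) = (L : f(Q)) * (N : C_N(Q))`. The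
first factor of the count divides `(f(Z) : f(Q))` by induction, and the second one divides
`(N : C_N(Q))` because `(B : H ∩ B)` divides `(N : H)` for any subgroups `H` and `B` of a nilpotent
group `N`.

Since the induction hypothesis is needed for `f(Z)` rather than `L`, the induction is over all
subgroups of groups with a series of successive quotients by nilpotent normal Hall subgroups. A
Sylow tower gives such a series, and so does supersolubility, because the Sylow subgroup for the
largest prime divisor of the order of a supersoluble group is normal.
-/

open Subgroup
open scoped Pointwise

section Conjugation

variable {G L : Type*} [Group G] [Group L]

theorem mem_normalizer_iff_conj_smul_eq {g : G} {Q : Subgroup G} :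
    g ∈ normalizer (Q : Set G) ↔ MulAut.conj g • Q = Q :=
  mem_normalizer_iff_map_conj_eq

theorem map_conj_smul (f : G →* L) (g : G) (Q : Subgroup G) :
    (MulAut.conj g • Q).map f = MulAut.conj (f g) • Q.map f := by
  change (Q.map (MulAut.conj g).toMonoidHom).map f =
    (Q.map f).map (MulAut.conj (f g)).toMonoidHom
  rw [map_map, map_map]
  congr 1
  ext x
  simp

theorem map_conj_smul_of_mem_ker {f : G →* L} {u : G} (hu : u ∈ f.ker) (Q : Subgroup G) :
    (MulAut.conj u • Q).map f = Q.map f := by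
  rw [map_conj_smul, MonoidHom.mem_ker.1 hu, map_one, one_smul]

theorem conj_smul_le {Z Q : Subgroup G} {g : G} (hg : g ∈ Z) (hQ : Q ≤ Z) :
    MulAut.conj g • Q ≤ Z :=
  conj_smul_le_of_le hQ ⟨g, hg⟩

theorem natCard_conj_smul (g : G) (Q : Subgroup G) :
    Nat.card ↥(MulAut.conj g • Q) = Nat.card Q :=
  (Nat.card_congr (equivSMul (MulAut.conj g) Q).toEquiv).symm

theorem natCard_subgroupOf_of_le {Q Z : Subgroup G} (h : Q ≤ Z) :
    Nat.card (Q.subgroupOf Z) = Nat.card Q :=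
  Nat.card_congr (subgroupOfEquivOfLe h).toEquiv

theorem conj_smul_subgroupOf_eq_iff {Z Q R : Subgroup G} (hQ : Q ≤ Z) (hR : R ≤ Z) {u : Z} :
    MulAut.conj u • Q.subgroupOf Z = R.subgroupOf Z ↔ MulAut.conj (u : G) • Q = R := by
  rw [conj_smul_subgroupOf hQ, subgroupOf_inj, inf_eq_left.2 (conj_smul_le u.2 hQ),
    inf_eq_left.2 hR]

theorem conj_smul_centralizer (g : G) (Q : Subgroup G) :
    MulAut.conj g • centralizer (Q : Set G) =
      centralizer ((MulAut.conj g • Q : Subgroup G) : Set G) := by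
  ext x
  obtain ⟨y, rfl⟩ := (MulAut.conj g).surjective x
  rw [← MulAut.smul_def, smul_mem_pointwise_smul_iff, mem_centralizer_iff, mem_centralizer_iff,
    coe_pointwise_smul, ← Set.image_smul, Set.forall_mem_image]
  simp only [← smul_mul', SetLike.mem_coe, smul_left_cancel_iff]

end Conjugation

section Counting

theorem natCard_eq_mul_of_forall_natCard_fiber_eq {α β : Type*} {k : ℕ} (g : α → β)
    (h : ∀ b, Nat.card {a // g a = b} = k) : Nat.card α = Nat.card β * k := by
  rcases k.eq_zero_or_pos with rfl | hk
  · rw [mul_zero]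
    by_contra hα
    obtain ⟨⟨a⟩, _⟩ := Nat.card_ne_zero.1 hα
    have : Nonempty {x // g x = g a} := ⟨a, rfl⟩
    exact Nat.card_pos.ne' (h (g a))
  · have (b : β) : Finite {a // g a = b} := Nat.finite_of_card_ne_zero (h b ▸ hk.ne')
    rw [Nat.card_congr ((Equiv.sigmaFiberEquiv g).symm.trans
      ((Equiv.sigmaCongrRight fun b => Finite.equivFinOfCardEq (h b)).trans
        (Equiv.sigmaEquivProd β (Fin k)))), Nat.card_prod, Nat.card_fin]

variable {G : Type*} [Group G]

theorem relIndex_mul_natCard_inf (H K : Subgroup G) :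
    H.relIndex K * Nat.card ↥(H ⊓ K) = Nat.card K := by
  rw [← relIndex_bot_left (H ⊓ K), mul_comm, relIndex_inf_mul_relIndex, bot_inf_eq,
    relIndex_bot_left]

theorem relIndex_sup_of_normal [Finite G] (H N : Subgroup G) [N.Normal] :
    H.relIndex (H ⊔ N) = H.relIndex N := by
  have hpos : N.relIndex H ≠ 0 := FiniteIndex.index_ne_zero
  refine Nat.eq_of_mul_eq_mul_left (Nat.pos_of_ne_zero hpos) ?_
  calc N.relIndex H * H.relIndex (H ⊔ N) = (N ⊓ H).relIndex (H ⊔ N) := by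
        rw [← inf_relIndex_right, relIndex_mul_relIndex _ _ _ inf_le_right le_sup_left]
    _ = H.relIndex N * N.relIndex (H ⊔ N) := by
        rw [← inf_relIndex_left N H, relIndex_mul_relIndex _ _ _ inf_le_left le_sup_right]
    _ = N.relIndex H * H.relIndex N := by rw [relIndex_sup_right, mul_comm]

theorem natCard_conj_smul_eq (B Q : Subgroup G) :
    Nat.card {R : Subgroup G // ∃ u ∈ B, MulAut.conj u • Q = R} =
      (normalizer (Q : Set G)).relIndex B := by
  let _ : MulAction B (Subgroup G) := MulAction.compHom _ (MulAut.conj.comp B.subtype)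
  have hstab : MulAction.stabilizer B Q = (normalizer (Q : Set G)).subgroupOf B := by
    ext u
    exact mem_normalizer_iff_conj_smul_eq.symm
  rw [relIndex, ← hstab, MulAction.index_stabilizer]
  exact Nat.card_congr (Equiv.subtypeEquivRight fun _ =>
    ⟨fun ⟨u, hu, e⟩ => ⟨⟨u, hu⟩, e⟩, fun ⟨u, e⟩ => ⟨u, u.2, e⟩⟩)

end Counting

section SchurZassenhaus

open MulOpposite MulAction

variable {G : Type*} [Group G]

theorem isComplement'_subgroupOf_sup {N Q : Subgroup G} [N.Normal]
    (h : (Nat.card N).Coprime (Nat.card Q)) :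
    IsComplement' (N.subgroupOf (N ⊔ Q)) (Q.subgroupOf (N ⊔ Q)) := by
  refine isComplement'_of_disjoint_and_mul_eq_univ ?_ ?_
  · rw [disjoint_iff, subgroupOf, subgroupOf, ← comap_inf, (disjoint_of_coprime_natCard h).eq_bot]
    exact bot_subgroupOf _
  · rw [← normal_mul, (codisjoint_subgroupOf_sup N Q).eq_top, coe_top]

variable [Finite G]

/- The proof of the existence part in Mathlib makes a commutative `N` act on the classes of
its transversals; the stabilizers of the classes are then all the complements of `N`. -/
theorem exists_stabilizer_quotientDiff_eq {N Q : Subgroup G} [N.Normal] [IsMulCommutative N]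
    (hN : (Nat.card N).Coprime N.index) (hQ : IsComplement' N Q) :
    ∃ α : N.QuotientDiff, stabilizer G α = Q := by
  let α : N.QuotientDiff := Quotient.mk'' ⟨(Q : Set G), hQ.symm⟩
  have hle : Q ≤ stabilizer G α := fun q hq => by
    refine mem_stabilizer_iff.2 (congr_arg Quotient.mk'' (Subtype.ext ?_))
    exact op_smul_coe_set (inv_mem hq)
  have hcard : Nat.card N * Nat.card Q = Nat.card N * Nat.card (stabilizer G α) :=
    hQ.card_mul_card.trans (isComplement'_stabilizer_of_coprime hN).card_mul_card.symm
  exact ⟨α, (eq_of_le_of_card_ge hle (Nat.eq_of_mul_eq_mul_left Nat.card_pos hcard).ge).symm⟩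

theorem exists_conj_smul_eq_of_isComplement'_of_isMulCommutative {N Q R : Subgroup G} [N.Normal]
    [IsMulCommutative N] (hN : (Nat.card N).Coprime N.index) (hQ : IsComplement' N Q)
    (hR : IsComplement' N R) : ∃ u ∈ N, MulAut.conj u • Q = R := by
  obtain ⟨α, rfl⟩ := exists_stabilizer_quotientDiff_eq hN hQ
  obtain ⟨β, rfl⟩ := exists_stabilizer_quotientDiff_eq hN hR
  obtain ⟨u, rfl⟩ := exists_smul_eq hN α β
  exact ⟨u, u.2, (stabilizer_smul_eq_stabilizer_map_conj (u : G) α).symm⟩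

theorem exists_conj_smul_eq_of_sup_eq_of_isMulCommutative {N Q R : Subgroup G} [N.Normal]
    [IsMulCommutative N] (hQ : (Nat.card N).Coprime (Nat.card Q))
    (hR : (Nat.card N).Coprime (Nat.card R)) (h : N ⊔ Q = N ⊔ R) :
    ∃ u ∈ N, MulAut.conj u • Q = R := by
  have hcQ := isComplement'_subgroupOf_sup hQ
  have hcR := isComplement'_subgroupOf_sup hR
  rw [← h] at hcR
  have hQK : Q ≤ N ⊔ Q := le_sup_right
  have hRK : R ≤ N ⊔ Q := h ▸ le_sup_right
  have hN : (Nat.card (N.subgroupOf (N ⊔ Q))).Coprime (N.subgroupOf (N ⊔ Q)).index := by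
    rw [hcQ.symm.index_eq_card, natCard_subgroupOf_of_le le_sup_left, natCard_subgroupOf_of_le hQK]
    exact hQ
  obtain ⟨u, hu, e⟩ := exists_conj_smul_eq_of_isComplement'_of_isMulCommutative hN hcQ hcR
  exact ⟨u, hu, (conj_smul_subgroupOf_eq_iff hQK hRK).1 e⟩

theorem exists_conj_smul_eq_of_sup_eq {N Q R : Subgroup G} [N.Normal] [Group.IsSolvable N]
    (hQ : (Nat.card N).Coprime (Nat.card Q)) (hR : (Nat.card N).Coprime (Nat.card R))
    (h : N ⊔ Q = N ⊔ R) : ∃ u ∈ N, MulAut.conj u • Q = R := by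
  induction hn : Nat.card N using Nat.strong_induction_on generalizing N Q R with
  | _ n ih =>
  rcases subsingleton_or_nontrivial N with hN | hN
  · rw [eq_bot_of_subsingleton N, bot_sup_eq, bot_sup_eq] at h
    exact ⟨1, one_mem N, by rw [map_one, one_smul, h]⟩
  have hAN : ⁅N, N⁆ < N := by
    rw [← map_subtype_commutator]
    conv_rhs => rw [← range_subtype N, MonoidHom.range_eq_map]
    exact (map_lt_map_iff_of_injective N.subtype_injective).2
      (Group.IsSolvable.commutator_lt_top_of_nontrivial N)
  set A := ⁅N, N⁆
  have hA : Nat.card A ∣ Nat.card N := card_dvd_of_le hAN.le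
  set π := QuotientGroup.mk' A
  have : IsMulCommutative (N.map π) := by
    rw [← le_centralizer_iff_isMulCommutative, ← commutator_eq_bot_iff_le_centralizer,
      ← map_commutator, Subgroup.map_eq_bot_iff, QuotientGroup.ker_mk']
  have hπ (S : Subgroup G) : (Nat.card N).Coprime (Nat.card S) →
      (Nat.card (N.map π)).Coprime (Nat.card (S.map π)) :=
    Nat.Coprime.of_dvd (card_map_dvd _ _) (card_map_dvd _ _)
  have : (N.map π).Normal := Normal.map ‹_› π (QuotientGroup.mk'_surjective A)
  obtain ⟨_, ⟨w, hw, rfl⟩, e⟩ :=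
    exists_conj_smul_eq_of_sup_eq_of_isMulCommutative (hπ Q hQ) (hπ R hR)
      (by rw [← Subgroup.map_sup, h, Subgroup.map_sup])
  rw [← map_conj_smul, map_eq_map_iff, QuotientGroup.ker_mk', sup_comm, sup_comm R] at e
  have : Group.IsSolvable A := Group.isSolvable_of_isSolvable_injective (inclusion_injective hAN.le)
  obtain ⟨v, hv, e'⟩ := ih (Nat.card A) (hn ▸ Set.ncard_lt_ncard hAN)
    (by rw [natCard_conj_smul]; exact hQ.coprime_dvd_left hA) (hR.coprime_dvd_left hA) e rfl
  exact ⟨v * w, mul_mem (hAN.le hv) hw, by rw [map_mul, mul_smul, e']⟩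

theorem exists_conj_smul_eq_of_map_eq {L : Type*} [Group L] {f : G →* L} [Group.IsSolvable f.ker]
    {Z Q R : Subgroup G} (hQ : (Nat.card f.ker).Coprime (Nat.card Q))
    (hR : (Nat.card f.ker).Coprime (Nat.card R)) (hQZ : Q ≤ Z) (hRZ : R ≤ Z)
    (h : Q.map f = R.map f) : ∃ u ∈ f.ker ⊓ Z, MulAut.conj u • Q = R := by
  have hinj : Function.Injective (Z.subtype.subgroupComap f.ker) := fun x y h => by
    have hxy : ((x : Z) : G) = y := congr_arg f.ker.subtype h
    exact Subtype.ext (Subtype.ext hxy)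
  have : Group.IsSolvable (f.ker.subgroupOf Z) := Group.isSolvable_of_isSolvable_injective hinj
  have hcop {S : Subgroup G} (hS : (Nat.card f.ker).Coprime (Nat.card S)) (hSZ : S ≤ Z) :
      (Nat.card (f.ker.subgroupOf Z)).Coprime (Nat.card (S.subgroupOf Z)) := by
    rw [natCard_subgroupOf_of_le hSZ]
    exact hS.coprime_dvd_left (card_comap_dvd_of_injective _ _ Z.subtype_injective)
  have hsup : f.ker.subgroupOf Z ⊔ Q.subgroupOf Z = f.ker.subgroupOf Z ⊔ R.subgroupOf Z := by
    rw [sup_comm, sup_comm _ (R.subgroupOf Z)]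
    refine (map_eq_map_iff (f := f.comp Z.subtype)).1 ?_
    rw [← map_map, ← map_map, map_subgroupOf_eq_of_le hQZ, map_subgroupOf_eq_of_le hRZ, h]
  obtain ⟨u, hu, e⟩ := exists_conj_smul_eq_of_sup_eq (hcop hQ hQZ) (hcop hR hRZ) hsup
  exact ⟨u, ⟨hu, u.2⟩, (conj_smul_subgroupOf_eq_iff hQZ hRZ).1 e⟩

end SchurZassenhaus

section Nilpotent

variable {G : Type*} [Group G]

theorem isNilpotent_of_injective {H : Type*} [Group H] [Group.IsNilpotent H] {f : G →* H}
    (hf : Function.Injective f) : Group.IsNilpotent G :=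
  Subgroup.isNilpotent_of_ker_le_center f ((f.ker_eq_bot_iff.2 hf).trans_le bot_le)

theorem eq_of_normalizer_eq_self_of_le {D E : Subgroup G} [Group.IsNilpotent E] (hDE : D ≤ E)
    (hD : normalizer (D : Set G) = D) : D = E := by
  have hself : normalizer (D.subgroupOf E : Set E) = D.subgroupOf E := by
    rw [← subgroupOf_normalizer_eq hDE, hD]
  exact le_antisymm hDE (subgroupOf_eq_top.1
    (normalizerCondition_iff_only_full_group_self_normalizing.1
      Group.normalizerCondition_of_isNilpotent _ hself))

variable [Finite G]

theorem commute_of_isNilpotent_of_coprime [Group.IsNilpotent G] {x y : G}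
    (h : (orderOf x).Coprime (orderOf y)) : Commute x y := by
  obtain ⟨e⟩ := ((Group.isNilpotent_of_finite_tfae (G := G)).out 0 4).1 ‹_›
  suffices hxy : Commute (e.symm x) (e.symm y) by simpa using hxy.map e
  ext q P
  have hq : Fact (q : ℕ).Prime := ⟨Nat.prime_of_mem_primeFactors q.2⟩
  let φ : G →* P := ((Pi.evalMonoidHom _ P).comp (Pi.evalMonoidHom _ q)).comp e.symm.toMonoidHom
  obtain ⟨a, ha⟩ := IsPGroup.iff_orderOf.1 P.isPGroup' (φ x)
  obtain ⟨b, hb⟩ := IsPGroup.iff_orderOf.1 P.isPGroup' (φ y)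
  have hab : Nat.Coprime ((q : ℕ) ^ a) ((q : ℕ) ^ b) :=
    ha ▸ hb ▸ Nat.Coprime.of_dvd (orderOf_map_dvd φ x) (orderOf_map_dvd φ y) h
  have hφ : Commute (φ x) (φ y) := by
    rcases Nat.eq_zero_or_pos a with rfl | ha₀
    · rw [pow_zero, orderOf_eq_one_iff] at ha
      exact ha ▸ Commute.one_left _
    rcases Nat.eq_zero_or_pos b with rfl | hb₀
    · rw [pow_zero, orderOf_eq_one_iff] at hb
      exact hb ▸ Commute.one_right _
    rw [Nat.coprime_pow_left_iff ha₀, Nat.coprime_pow_right_iff hb₀, Nat.coprime_self] at hab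
    exact absurd hab hq.out.ne_one
  exact congr_arg Subtype.val hφ

theorem relIndex_dvd_index_of_isNilpotent [Group.IsNilpotent G] (H B : Subgroup G) :
    H.relIndex B ∣ H.index := by
  induction H using WellFoundedGT.induction with
  | _ H ih =>
  rcases eq_or_ne H ⊤ with rfl | hH
  · rw [relIndex_top_left, index_top]
  set N := normalizer (H : Set G)
  have hHN : H < N := Group.normalizerCondition_of_isNilpotent H hH.lt_top
  have hnormal : H.relIndex (N ⊓ B) ∣ H.relIndex N := by
    rw [← relIndex_subgroupOf (inf_le_left : N ⊓ B ≤ N)]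
    exact relIndex_dvd_index_of_normal _ _
  rw [← inf_eq_left.2 hHN.le, ← relIndex_inf_mul_relIndex, inf_eq_left.2 hHN.le,
    ← relIndex_mul_index hHN.le]
  exact mul_dvd_mul hnormal (ih N hHN)

theorem relIndex_dvd_relIndex_of_isNilpotent {H B P : Subgroup G} [Group.IsNilpotent P]
    (hB : B ≤ P) : H.relIndex B ∣ H.relIndex P := by
  rw [← relIndex_subgroupOf hB]
  exact relIndex_dvd_index_of_isNilpotent _ _

end Nilpotent

section IsCarterSubgroup

variable {G : Type*} [Group G]

theorem IsCarterSubgroup.conj_smul {C : Subgroup G} (hC : IsCarterSubgroup C) (g : G) :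
    IsCarterSubgroup (MulAut.conj g • C) := by
  have := hC.1
  refine ⟨Group.nilpotent_of_mulEquiv (equivSMul (MulAut.conj g) C), ?_⟩
  have h := map_equiv_normalizer_eq C (MulAut.conj g)
  rw [hC.2] at h
  exact h.symm

theorem IsCarterSubgroup.subgroupOf {C W : Subgroup G} (hC : IsCarterSubgroup C) (hCW : C ≤ W) :
    IsCarterSubgroup (C.subgroupOf W) := by
  have := hC.1
  refine ⟨Group.nilpotent_of_mulEquiv (subgroupOfEquivOfLe hCW).symm, ?_⟩
  rw [← subgroupOf_normalizer_eq hCW, hC.2]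

theorem natCard_isCarterSubgroup_between_eq_carterCount {W R₀ Y : Subgroup G}
    (hR₀ : IsCarterSubgroup R₀) (hRW : R₀ ≤ W) (hY : Y ≤ W)
    (hconj : ∀ C D : Subgroup W, IsCarterSubgroup C → IsCarterSubgroup D →
      ∃ g : W, MulAut.conj g • C = D) :
    Nat.card {R : Subgroup G // IsCarterSubgroup R ∧ Y ≤ R ∧ R ≤ W} =
      carterCount (Y.subgroupOf W) := by
  have hcarter {S : Subgroup W} (hS : IsCarterSubgroup S) :
      IsCarterSubgroup (S.map W.subtype) := by
    obtain ⟨g, rfl⟩ := hconj _ _ (hR₀.subgroupOf hRW) hS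
    rw [map_conj_smul, map_subgroupOf_eq_of_le hRW]
    exact hR₀.conj_smul _
  refine Nat.card_congr ⟨fun R => ⟨R.1.subgroupOf W, R.2.1.subgroupOf R.2.2.2, comap_mono R.2.2.1⟩,
    fun S => ⟨S.1.map W.subtype, hcarter S.2.1, ?_, map_subtype_le _⟩, fun R => ?_, fun S => ?_⟩
  · exact (map_subgroupOf_eq_of_le hY).ge.trans (map_mono S.2.2)
  · exact Subtype.ext (map_subgroupOf_eq_of_le R.2.2.2)
  · exact Subtype.ext (comap_map_eq_self_of_injective W.subtype_injective _)

end IsCarterSubgroup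

section CentralizerExtension

variable {G L : Type*} [Group G] [Group L] {f : G →* L} {Q R Y Z : Subgroup G}

theorem map_inf_comap (f : G →* L) (K : Subgroup G) (S : Subgroup L) :
    (K ⊓ S.comap f).map f = K.map f ⊓ S :=
  SetLike.coe_injective (Set.image_inter_preimage f K S)

theorem eq_of_map_eq_of_disjoint_ker (hQ : Disjoint f.ker Q) {x y : G} (hx : x ∈ Q) (hy : y ∈ Q)
    (h : f x = f y) : x = y := by
  have hxy : x * y⁻¹ ∈ f.ker := MonoidHom.mem_ker.2 (by rw [map_mul, map_inv, h, mul_inv_cancel])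
  exact mul_inv_eq_one.1 (disjoint_def.1 hQ hxy (mul_mem hx (inv_mem hy)))

theorem mem_centralizer_of_conj_smul_le (hR : Disjoint f.ker R) {u : G} (hu : u ∈ f.ker)
    (hYR : Y ≤ R) (h : MulAut.conj u • Y ≤ R) : u ∈ centralizer (Y : Set G) := by
  intro y hy
  have hconj : u * y * u⁻¹ ∈ R := h (smul_mem_pointwise_smul y (MulAut.conj u) Y hy)
  have hfix : u * y * u⁻¹ = y := eq_of_map_eq_of_disjoint_ker hR hconj (hYR hy) (by
    rw [map_mul, map_mul, map_inv, MonoidHom.mem_ker.1 hu, one_mul, inv_one, mul_one])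
  exact (mul_inv_eq_iff_eq_mul.1 hfix).symm

theorem conj_smul_eq_self_iff_mem_centralizer (hQ : Disjoint f.ker Q) {u : G} (hu : u ∈ f.ker) :
    MulAut.conj u • Q = Q ↔ u ∈ centralizer (Q : Set G) :=
  ⟨fun h => mem_centralizer_of_conj_smul_le hQ hu le_rfl h.le, fun h =>
    mem_normalizer_iff_conj_smul_eq.1 (centralizer_le_normalizer _ h)⟩

/-- The subgroup `Q · C_N(Q)`, where `N` is the kernel of `f`. When `N` and `Q` are nilpotent of
coprime orders, this is the largest nilpotent subgroup that contains `Q` and has the same image. -/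
def centralizerExtension (f : G →* L) (Q : Subgroup G) : Subgroup G :=
  Q ⊔ (f.ker ⊓ centralizer (Q : Set G))

theorem le_centralizerExtension (f : G →* L) (Q : Subgroup G) : Q ≤ centralizerExtension f Q :=
  le_sup_left

theorem mem_centralizerExtension {x : G} :
    x ∈ centralizerExtension f Q ↔
      ∃ q ∈ Q, ∃ u ∈ f.ker ⊓ centralizer (Q : Set G), q * u = x := by
  have hle : Q ≤ normalizer (f.ker ⊓ centralizer (Q : Set G) : Subgroup G) :=
    (le_centralizer_iff.1 (inf_le_right (a := f.ker))).trans (centralizer_le_normalizer _)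
  rw [← SetLike.mem_coe, centralizerExtension, coe_mul_of_left_le_normalizer_right _ _ hle,
    Set.mem_mul]
  rfl

theorem map_centralizerExtension (f : G →* L) (Q : Subgroup G) :
    (centralizerExtension f Q).map f = Q.map f := by
  rw [centralizerExtension, Subgroup.map_sup, (Subgroup.map_eq_bot_iff _).2 inf_le_left,
    sup_bot_eq]

theorem conj_smul_centralizerExtension (g : G) (Q : Subgroup G) :
    MulAut.conj g • centralizerExtension f Q = centralizerExtension f (MulAut.conj g • Q) := by
  rw [centralizerExtension, centralizerExtension, smul_sup, smul_inf, conj_smul_centralizer,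
    Normal.conj_smul_eq_self g f.ker]

theorem exists_mul_eq_of_map_eq (hQR : Q ≤ R) (h : Q.map f = R.map f) {x : G} (hx : x ∈ R) :
    ∃ q ∈ Q, ∃ u ∈ f.ker ⊓ R, q * u = x := by
  obtain ⟨q, hq : q ∈ Q, hqx⟩ := h.ge (mem_map_of_mem f hx)
  have hker : q⁻¹ * x ∈ f.ker := by
    rw [MonoidHom.mem_ker, map_mul, map_inv, hqx, inv_mul_cancel]
  exact ⟨q, hq, q⁻¹ * x, ⟨hker, R.mul_mem (R.inv_mem (hQR hq)) hx⟩, mul_inv_cancel_left q x⟩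

theorem ker_inf_centralizerExtension (hQ : Disjoint f.ker Q) :
    f.ker ⊓ centralizerExtension f Q = f.ker ⊓ centralizer (Q : Set G) := by
  refine le_antisymm ?_ (le_inf inf_le_left le_sup_right)
  rintro x ⟨hx, hx'⟩
  obtain ⟨q, hq, u, hu, rfl⟩ := mem_centralizerExtension.1 hx'
  have hq_one : q = 1 := disjoint_def.1 hQ ((f.ker.mul_mem_cancel_right hu.1).1 hx) hq
  rwa [hq_one, one_mul]

theorem le_of_le_centralizerExtension (hQ : (Nat.card f.ker).Coprime (Nat.card Q))
    (hY : Disjoint f.ker Y) (h : Y ≤ centralizerExtension f Q) : Y ≤ Q := by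
  intro y hy
  obtain ⟨q, hq, u, hu, rfl⟩ := mem_centralizerExtension.1 (h hy)
  have hpow : (q * u) ^ Nat.card Q = u ^ Nat.card Q := by
    rw [(show Commute q u from hu.2 q hq).mul_pow,
      orderOf_dvd_iff_pow_eq_one.1 (Q.orderOf_dvd_natCard hq), one_mul]
  have hu_pow : u ^ Nat.card Q = 1 :=
    disjoint_def.1 hY (pow_mem hu.1 _) (hpow ▸ pow_mem hy _)
  have hu_one : orderOf u = 1 := Nat.eq_one_of_dvd_coprimes hQ
    (f.ker.orderOf_dvd_natCard hu.1) (orderOf_dvd_of_pow_eq_one hu_pow)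
  rwa [orderOf_eq_one_iff.1 hu_one, mul_one]

theorem centralizerExtension_injOn (f : G →* L) :
    Set.InjOn (centralizerExtension f) {Q | (Nat.card f.ker).Coprime (Nat.card Q)} :=
  fun Q hQ R hR h => le_antisymm
    (le_of_le_centralizerExtension hR (disjoint_of_coprime_natCard hQ)
      (h ▸ le_centralizerExtension f Q))
    (le_of_le_centralizerExtension hQ (disjoint_of_coprime_natCard hR)
      (h ▸ le_centralizerExtension f R))

theorem isNilpotent_centralizerExtension [Group.IsNilpotent f.ker] [Group.IsNilpotent Q] :
    Group.IsNilpotent (centralizerExtension f Q) := by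
  let C := f.ker ⊓ centralizer (Q : Set G)
  have : Group.IsNilpotent C := isNilpotent_of_injective (inclusion_injective inf_le_left)
  let φ : Q × C →* G := Q.subtype.noncommCoprod C.subtype fun q u => (mem_inf.1 u.2).2 q q.2
  have hφ : φ.range = centralizerExtension f Q := by
    refine (MonoidHom.noncommCoprod_range _ _ _).trans ?_
    rw [range_subtype, range_subtype, centralizerExtension]
  exact hφ ▸ Group.nilpotent_of_surjective φ.rangeRestrict φ.rangeRestrict_surjective

theorem isCarterSubgroup_centralizerExtension [Group.IsNilpotent f.ker]
    (hQ : (Nat.card f.ker).Coprime (Nat.card Q)) (hC : IsCarterSubgroup (Q.map f)) :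
    IsCarterSubgroup (centralizerExtension f Q) := by
  have hdisj := disjoint_of_coprime_natCard hQ
  have hinj : Function.Injective (f.subgroupMap Q) := fun x y h =>
    Subtype.ext (eq_of_map_eq_of_disjoint_ker hdisj x.2 y.2 (congr_arg Subtype.val h))
  have : Group.IsNilpotent (Q.map f) := hC.1
  have : Group.IsNilpotent Q := isNilpotent_of_injective hinj
  refine ⟨isNilpotent_centralizerExtension, le_antisymm (fun g hg => ?_) le_normalizer⟩
  rw [mem_normalizer_iff_conj_smul_eq, conj_smul_centralizerExtension] at hg
  have hgQ : MulAut.conj g • Q = Q :=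
    centralizerExtension_injOn f (by rwa [Set.mem_ofPred, natCard_conj_smul]) hQ hg
  obtain ⟨q, hq, hqg⟩ : f g ∈ Q.map f := by
    rw [← hC.2, mem_normalizer_iff_conj_smul_eq, ← map_conj_smul, hgQ]
  have hker : q⁻¹ * g ∈ f.ker := by
    rw [MonoidHom.mem_ker, map_mul, map_inv, hqg, inv_mul_cancel]
  have hfix : MulAut.conj (q⁻¹ * g) • Q = Q := by
    rw [map_mul, mul_smul, hgQ, conj_smul_eq_self_of_mem (inv_mem hq)]
  exact mem_centralizerExtension.2 ⟨q, hq, q⁻¹ * g,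
    ⟨hker, (conj_smul_eq_self_iff_mem_centralizer hdisj hker).1 hfix⟩, mul_inv_cancel_left q g⟩

theorem exists_le_coprime_map_eq (hL : (Nat.card f.ker).Coprime (Nat.card L)) (K : Subgroup G) :
    ∃ Q ≤ K, (Nat.card f.ker).Coprime (Nat.card Q) ∧ Q.map f = K.map f := by
  have hindex : (Nat.card f.ker).Coprime (f.ker.subgroupOf K).index :=
    hL.coprime_dvd_right ((relIndex_ker K f).dvd.trans (card_subgroup_dvd_card _))
  obtain ⟨Q, hQ⟩ := exists_right_complement'_of_coprime (N := f.ker.subgroupOf K)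
    (hindex.coprime_dvd_left (card_comap_dvd_of_injective _ _ K.subtype_injective))
  refine ⟨Q.map K.subtype, map_subtype_le _, ?_, ?_⟩
  · rwa [card_map_of_injective K.subtype_injective, ← hQ.symm.index_eq_card]
  · have hsup : Q ⊔ (f.comp K.subtype).ker = ⊤ ⊔ (f.comp K.subtype).ker := by
      rw [top_sup_eq]
      exact hQ.symm.sup_eq_top
    rw [map_map, map_eq_map_iff.2 hsup, ← map_map, ← MonoidHom.range_eq_map, range_subtype]

theorem le_centralizerExtension_iff {X : Subgroup G} (hQ : (Nat.card f.ker).Coprime (Nat.card Q))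
    (hY : (Nat.card f.ker).Coprime (Nat.card Y)) (hYX : Y ≤ X) (hf : Y.map f = X.map f) :
    X ≤ centralizerExtension f Q ↔
      Y ≤ Q ∧ Q ≤ centralizer ((X ⊓ f.ker : Subgroup G) : Set G) := by
  rw [le_centralizer_iff (H := Q)]
  constructor
  · intro h
    have hker : X ⊓ f.ker ≤ f.ker ⊓ centralizer (Q : Set G) := by
      rw [← ker_inf_centralizerExtension (disjoint_of_coprime_natCard hQ)]
      exact le_inf inf_le_right (inf_le_left.trans h)
    exact ⟨le_of_le_centralizerExtension hQ (disjoint_of_coprime_natCard hY) (hYX.trans h),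
      hker.trans inf_le_right⟩
  · rintro ⟨hYQ, hX⟩ x hx
    obtain ⟨y, hy, u, hu, rfl⟩ := exists_mul_eq_of_map_eq hYX hf hx
    exact mem_centralizerExtension.2 ⟨y, hYQ hy, u, ⟨hu.1, hX (mem_inf.2 hu.symm)⟩, rfl⟩

variable [Finite G]

theorem exists_map_eq_and_conj_smul_eq [Group.IsSolvable f.ker]
    (hQ : (Nat.card f.ker).Coprime (Nat.card Q)) (hR : (Nat.card f.ker).Coprime (Nat.card R))
    (hQZ : Q ≤ Z) (hRZ : R ≤ Z) {z : G} (hz : z ∈ Z)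
    (h : MulAut.conj (f z) • Q.map f = R.map f) :
    ∃ w ∈ Z, f w = f z ∧ MulAut.conj w • Q = R := by
  rw [← map_conj_smul] at h
  obtain ⟨u, hu, e⟩ := exists_conj_smul_eq_of_map_eq (by rwa [natCard_conj_smul]) hR
    (conj_smul_le hz hQZ) hRZ h
  refine ⟨u * z, mul_mem hu.2 hz, ?_, by rw [map_mul, mul_smul, e]⟩
  rw [map_mul, MonoidHom.mem_ker.1 hu.1, one_mul]

theorem exists_le_coprime_map_eq_of_le [Group.IsSolvable f.ker]
    (hL : (Nat.card f.ker).Coprime (Nat.card L)) {K : Subgroup G}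
    (hY : (Nat.card f.ker).Coprime (Nat.card Y)) (hYK : Y ≤ K) :
    ∃ Q ≤ K, Y ≤ Q ∧ (Nat.card f.ker).Coprime (Nat.card Q) ∧ Q.map f = K.map f := by
  obtain ⟨Q, hQK, hQ, hQf⟩ := exists_le_coprime_map_eq hL K
  have hYf : (Q ⊓ (Y.map f).comap f).map f = Y.map f := by
    rw [map_inf_comap, hQf, inf_eq_right.2 (map_mono hYK)]
  obtain ⟨u, hu, e⟩ := exists_conj_smul_eq_of_map_eq
    (hQ.coprime_dvd_right (card_dvd_of_le inf_le_left)) hY (inf_le_left.trans hQK) hYK hYf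
  refine ⟨MulAut.conj u • Q, conj_smul_le hu.2 hQK, ?_, by rwa [natCard_conj_smul], ?_⟩
  · exact e.ge.trans (smul_mono_right _ inf_le_left)
  · rw [map_conj_smul_of_mem_ker hu.1, hQf]

theorem le_centralizerExtension_of_isNilpotent {D : Subgroup G} [Group.IsNilpotent D]
    (hQ : (Nat.card f.ker).Coprime (Nat.card Q)) (hQD : Q ≤ D) (hf : Q.map f = D.map f) :
    D ≤ centralizerExtension f Q := by
  intro d hd
  obtain ⟨q, hq, u, ⟨hu, huD⟩, rfl⟩ := exists_mul_eq_of_map_eq hQD hf hd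
  refine mem_centralizerExtension.2 ⟨q, hq, u, ⟨hu, fun x hx => ?_⟩, rfl⟩
  have hcop : (orderOf (⟨x, hQD hx⟩ : D)).Coprime (orderOf (⟨u, huD⟩ : D)) := by
    rw [orderOf_mk, orderOf_mk]
    exact hQ.symm.of_dvd (Q.orderOf_dvd_natCard hx) (f.ker.orderOf_dvd_natCard hu)
  exact congr_arg Subtype.val (commute_of_isNilpotent_of_coprime hcop).eq

theorem IsCarterSubgroup.exists_eq_centralizerExtension [Group.IsNilpotent f.ker]
    (hL : (Nat.card f.ker).Coprime (Nat.card L)) (hsurj : Function.Surjective f)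
    {D : Subgroup G} (hD : IsCarterSubgroup D) :
    ∃ Q : Subgroup G, (Nat.card f.ker).Coprime (Nat.card Q) ∧ IsCarterSubgroup (Q.map f) ∧
      centralizerExtension f Q = D := by
  obtain ⟨Q, hQD, hQ, hQf⟩ := exists_le_coprime_map_eq hL D
  have := hD.1
  have : Group.IsNilpotent Q := isNilpotent_of_injective (inclusion_injective hQD)
  have : Group.IsNilpotent (centralizerExtension f Q) := isNilpotent_centralizerExtension
  have hDQ : D = centralizerExtension f Q := eq_of_normalizer_eq_self_of_le
    (le_centralizerExtension_of_isNilpotent hQ hQD hQf) hD.2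
  refine ⟨Q, hQ, ⟨Group.nilpotent_of_surjective _ (f.subgroupMap_surjective Q),
    le_antisymm (fun l hl => ?_) le_normalizer⟩, hDQ.symm⟩
  obtain ⟨g, rfl⟩ := hsurj l
  obtain ⟨w, -, hw, e⟩ := exists_map_eq_and_conj_smul_eq hQ hQ le_top le_top (mem_top g)
    (mem_normalizer_iff_conj_smul_eq.1 hl)
  have hwD : w ∈ D := by
    rw [← hD.2, mem_normalizer_iff_conj_smul_eq, hDQ, conj_smul_centralizerExtension, e]
  rw [← hw, hQf]
  exact mem_map_of_mem f hwD

theorem carterCount_eq_natCard [Group.IsNilpotent f.ker]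
    (hL : (Nat.card f.ker).Coprime (Nat.card L)) (hsurj : Function.Surjective f)
    {X : Subgroup G} (hY : (Nat.card f.ker).Coprime (Nat.card Y)) (hYX : Y ≤ X)
    (hf : Y.map f = X.map f) :
    carterCount X = Nat.card {Q : Subgroup G // (Nat.card f.ker).Coprime (Nat.card Q) ∧
      IsCarterSubgroup (Q.map f) ∧ Y ≤ Q ∧
        Q ≤ centralizer ((X ⊓ f.ker : Subgroup G) : Set G)} := by
  refine (Nat.card_congr (Equiv.ofBijective (fun Q => ⟨centralizerExtension f Q.1,
    isCarterSubgroup_centralizerExtension Q.2.1 Q.2.2.1,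
    (le_centralizerExtension_iff Q.2.1 hY hYX hf).2 Q.2.2.2⟩) ⟨?_, ?_⟩)).symm
  · rintro ⟨Q, hQ⟩ ⟨R, hR⟩ h
    exact Subtype.ext (centralizerExtension_injOn f hQ.1 hR.1 (congr_arg Subtype.val h))
  · rintro ⟨D, hD, hXD⟩
    obtain ⟨Q, hQ, hQf, rfl⟩ := hD.exists_eq_centralizerExtension hL hsurj
    exact ⟨⟨Q, hQ, hQf, (le_centralizerExtension_iff hQ hY hYX hf).1 hXD⟩, rfl⟩

theorem index_centralizerExtension (hsurj : Function.Surjective f) (hQ : Disjoint f.ker Q) :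
    (centralizerExtension f Q).index =
      (Q.map f).index * (centralizer (Q : Set G)).relIndex f.ker := by
  rw [← relIndex_mul_index (le_sup_left : centralizerExtension f Q ≤ _ ⊔ f.ker),
    relIndex_sup_of_normal, ← comap_map_eq, index_comap_of_surjective _ hsurj,
    map_centralizerExtension, ← inf_relIndex_right, inf_comm, ker_inf_centralizerExtension hQ,
    inf_comm, inf_relIndex_right, mul_comm]

theorem exists_conj_smul_eq_iff [Group.IsSolvable f.ker]
    (hQ : (Nat.card f.ker).Coprime (Nat.card Q)) (hYQ : Y ≤ Q) (hQZ : Q ≤ Z) :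
    (∃ u ∈ f.ker ⊓ Z ⊓ centralizer (Y : Set G), MulAut.conj u • Q = R) ↔
      (Nat.card f.ker).Coprime (Nat.card R) ∧ Y ≤ R ∧ R ≤ Z ∧ R.map f = Q.map f := by
  constructor
  · rintro ⟨u, ⟨⟨hu, huZ⟩, huY⟩, rfl⟩
    have hY : MulAut.conj u • Y = Y :=
      mem_normalizer_iff_conj_smul_eq.1 (centralizer_le_normalizer _ huY)
    exact ⟨by rwa [natCard_conj_smul], hY.ge.trans (smul_mono_right _ hYQ),
      conj_smul_le huZ hQZ, map_conj_smul_of_mem_ker hu Q⟩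
  · rintro ⟨hR, hYR, hRZ, hf⟩
    obtain ⟨u, hu, e⟩ := exists_conj_smul_eq_of_map_eq hQ hR hQZ hRZ hf.symm
    have huY : u ∈ centralizer (Y : Set G) := mem_centralizer_of_conj_smul_le
      (disjoint_of_coprime_natCard hR) hu.1 hYR ((smul_mono_right _ hYQ).trans e.le)
    exact ⟨u, ⟨hu, huY⟩, e⟩

theorem natCard_coprime_map_eq [Group.IsSolvable f.ker]
    (hQ : (Nat.card f.ker).Coprime (Nat.card Q)) (hYQ : Y ≤ Q) (hQZ : Q ≤ Z) :
    Nat.card {R : Subgroup G // (Nat.card f.ker).Coprime (Nat.card R) ∧ Y ≤ R ∧ R ≤ Z ∧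
        R.map f = Q.map f} =
      (centralizer (Q : Set G)).relIndex (f.ker ⊓ Z ⊓ centralizer (Y : Set G)) := by
  set B := f.ker ⊓ Z ⊓ centralizer (Y : Set G)
  have hnormalizer : normalizer (Q : Set G) ⊓ B = centralizer (Q : Set G) ⊓ B := by
    refine le_antisymm (le_inf ?_ inf_le_right) (inf_le_inf_right B (centralizer_le_normalizer _))
    rintro u ⟨hu, huB⟩
    exact (conj_smul_eq_self_iff_mem_centralizer (disjoint_of_coprime_natCard hQ) huB.1.1).1
      (mem_normalizer_iff_conj_smul_eq.1 hu)
  rw [← inf_relIndex_right, ← hnormalizer, inf_relIndex_right, ← natCard_conj_smul_eq]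
  exact Nat.card_congr (Equiv.subtypeEquivRight fun R =>
    (exists_conj_smul_eq_iff hQ hYQ hQZ).symm)

theorem relIndex_centralizer_conj_smul {w : G} (hw : w ∈ Z) (hYQ : Y ≤ Q)
    (hYR : Y ≤ MulAut.conj w • Q) :
    (centralizer ((MulAut.conj w • Q : Subgroup G) : Set G)).relIndex
        (f.ker ⊓ Z ⊓ centralizer (Y : Set G)) =
      (centralizer (Q : Set G)).relIndex (f.ker ⊓ Z ⊓ centralizer (Y : Set G)) := by
  have hinf {S : Subgroup G} (hS : Y ≤ S) :
      centralizer (S : Set G) ⊓ (f.ker ⊓ Z ⊓ centralizer (Y : Set G)) =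
        f.ker ⊓ Z ⊓ centralizer (S : Set G) := by
    rw [inf_comm, inf_assoc, inf_eq_right.2 (centralizer_le (SetLike.coe_subset_coe.2 hS))]
  have hconj : f.ker ⊓ Z ⊓ centralizer ((MulAut.conj w • Q : Subgroup G) : Set G) =
      MulAut.conj w • (f.ker ⊓ Z ⊓ centralizer (Q : Set G)) := by
    rw [smul_inf, smul_inf, conj_smul_centralizer, conj_smul_eq_self_of_mem hw,
      Normal.conj_smul_eq_self w f.ker]
  refine Nat.eq_of_mul_eq_mul_right
    (Nat.card_pos (α := ↥(f.ker ⊓ Z ⊓ centralizer (Q : Set G)))) ?_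
  rw [← hinf hYQ, relIndex_mul_natCard_inf, hinf hYQ, ← natCard_conj_smul w, ← hconj, ← hinf hYR,
    relIndex_mul_natCard_inf]

theorem natCard_isCarterSubgroup_map_eq_mul [Group.IsSolvable f.ker]
    (hL : (Nat.card f.ker).Coprime (Nat.card L))
    (hQ : (Nat.card f.ker).Coprime (Nat.card Q)) (hYQ : Y ≤ Q) (hQZ : Q ≤ Z)
    (hconj : ∀ R : Subgroup L, IsCarterSubgroup R → R ≤ Z.map f →
      ∃ l ∈ Z.map f, MulAut.conj l • Q.map f = R) :
    Nat.card {S : Subgroup G // (Nat.card f.ker).Coprime (Nat.card S) ∧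
        IsCarterSubgroup (S.map f) ∧ Y ≤ S ∧ S ≤ Z} =
      Nat.card {R : Subgroup L // IsCarterSubgroup R ∧ Y.map f ≤ R ∧ R ≤ Z.map f} *
        (centralizer (Q : Set G)).relIndex (f.ker ⊓ Z ⊓ centralizer (Y : Set G)) := by
  refine natCard_eq_mul_of_forall_natCard_fiber_eq
    (fun S => ⟨S.1.map f, S.2.2.1, map_mono S.2.2.2.1, map_mono S.2.2.2.2⟩) ?_
  rintro ⟨R, hR, hYR, hRZ⟩
  have hRf : (Z ⊓ R.comap f).map f = R := by rw [map_inf_comap, inf_eq_right.2 hRZ]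
  obtain ⟨S, hSZ, hYS, hS, hSf⟩ := exists_le_coprime_map_eq_of_le hL
    (hQ.coprime_dvd_right (card_dvd_of_le hYQ))
    (le_inf (hYQ.trans hQZ) (map_le_iff_le_comap.1 hYR))
  rw [hRf] at hSf
  have hSZ' : S ≤ Z := hSZ.trans inf_le_left
  obtain ⟨_, ⟨z, hz, rfl⟩, e⟩ := hconj R hR hRZ
  obtain ⟨w, hw, -, rfl⟩ := exists_map_eq_and_conj_smul_eq hQ hS hQZ hSZ' hz (e.trans hSf.symm)
  rw [← relIndex_centralizer_conj_smul hw hYQ hYS, ← natCard_coprime_map_eq hS hYS hSZ', hSf]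
  exact Nat.card_congr ⟨fun T => ⟨T.1.1, T.1.2.1, T.1.2.2.2.1, T.1.2.2.2.2,
    congr_arg Subtype.val T.2⟩, fun T => ⟨⟨T.1, T.2.1, T.2.2.2.2.symm ▸ hR, T.2.2.1, T.2.2.2.1⟩,
    Subtype.ext T.2.2.2.2⟩, fun _ => rfl, fun _ => rfl⟩

end CentralizerExtension

/-- The Carter subgroups of `G` are conjugate, and for `X ≤ C` with `C` a Carter subgroup the
number of Carter subgroups containing `X` divides the index of `C`. Conjugacy is included because
lifting the divisibility along a quotient map of `G` requires it. -/
structure IsCarterDivisible (G : Type*) [Group G] : Prop where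
  exists_conj_smul_eq (C D : Subgroup G) :
    IsCarterSubgroup C → IsCarterSubgroup D → ∃ g : G, MulAut.conj g • C = D
  carterCount_dvd_index (C X : Subgroup G) :
    IsCarterSubgroup C → X ≤ C → carterCount X ∣ C.index

namespace IsCarterDivisible

theorem of_subsingleton (G : Type*) [Group G] [Subsingleton G] : IsCarterDivisible G where
  exists_conj_smul_eq _ _ _ _ := ⟨1, Subsingleton.elim _ _⟩
  carterCount_dvd_index C X hC hX := by
    have : Nonempty {D : Subgroup G // IsCarterSubgroup D ∧ X ≤ D} := ⟨⟨C, hC, hX⟩⟩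
    rw [carterCount, Nat.card_unique]
    exact one_dvd _

variable {G L : Type*} [Group G] [Group L] [Finite G] {f : G →* L} [Group.IsNilpotent f.ker]

theorem exists_conj_smul_eq_of_surjective (hL : (Nat.card f.ker).Coprime (Nat.card L))
    (hsurj : Function.Surjective f) (h : IsCarterDivisible L) {C D : Subgroup G}
    (hC : IsCarterSubgroup C) (hD : IsCarterSubgroup D) : ∃ g : G, MulAut.conj g • C = D := by
  obtain ⟨Q, hQ, hQf, rfl⟩ := hC.exists_eq_centralizerExtension hL hsurj
  obtain ⟨R, hR, hRf, rfl⟩ := hD.exists_eq_centralizerExtension hL hsurj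
  obtain ⟨l, hl⟩ := h.exists_conj_smul_eq _ _ hQf hRf
  obtain ⟨g, rfl⟩ := hsurj l
  obtain ⟨w, -, -, rfl⟩ := exists_map_eq_and_conj_smul_eq hQ hR le_top le_top (mem_top g) hl
  exact ⟨w, conj_smul_centralizerExtension w Q⟩

theorem carterCount_dvd_index_of_surjective (hL : (Nat.card f.ker).Coprime (Nat.card L))
    (hsurj : Function.Surjective f) (h : ∀ W : Subgroup L, IsCarterDivisible W)
    {C X : Subgroup G} (hC : IsCarterSubgroup C) (hX : X ≤ C) : carterCount X ∣ C.index := by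
  obtain ⟨Q, hQ, hQf, rfl⟩ := hC.exists_eq_centralizerExtension hL hsurj
  obtain ⟨Y, hYX, hY, hYf⟩ := exists_le_coprime_map_eq hL X
  obtain ⟨hYQ, hQZ⟩ := (le_centralizerExtension_iff hQ hY hYX hYf).1 hX
  set Z := centralizer ((X ⊓ f.ker : Subgroup G) : Set G)
  set W := Z.map f
  have hQW : Q.map f ≤ W := map_mono hQZ
  have hconj (R : Subgroup L) (hR : IsCarterSubgroup R) (hRW : R ≤ W) :
      ∃ l ∈ W, MulAut.conj l • Q.map f = R := by
    obtain ⟨l, hl⟩ :=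
      (h W).exists_conj_smul_eq _ _ (hQf.subgroupOf hQW) (hR.subgroupOf hRW)
    exact ⟨l, l.2, (conj_smul_subgroupOf_eq_iff hQW hRW).1 hl⟩
  rw [carterCount_eq_natCard hL hsurj hY hYX hYf,
    natCard_isCarterSubgroup_map_eq_mul hL hQ hYQ hQZ hconj,
    natCard_isCarterSubgroup_between_eq_carterCount hQf hQW (map_mono (hYQ.trans hQZ))
      (h W).exists_conj_smul_eq,
    index_centralizerExtension hsurj (disjoint_of_coprime_natCard hQ)]
  have hdvd : carterCount ((Y.map f).subgroupOf W) ∣ (Q.map f).relIndex W :=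
    (h W).carterCount_dvd_index _ _ (hQf.subgroupOf hQW) (comap_mono (map_mono hYQ))
  exact mul_dvd_mul (hdvd.trans (relIndex_dvd_index_of_le hQW))
    (relIndex_dvd_relIndex_of_isNilpotent (inf_le_left.trans inf_le_left))

theorem of_surjective (hL : (Nat.card f.ker).Coprime (Nat.card L))
    (hsurj : Function.Surjective f) (h : IsCarterDivisible L)
    (hsub : ∀ W : Subgroup L, IsCarterDivisible W) : IsCarterDivisible G where
  exists_conj_smul_eq _ _ := exists_conj_smul_eq_of_surjective hL hsurj h
  carterCount_dvd_index _ _ := carterCount_dvd_index_of_surjective hL hsurj hsub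

end IsCarterDivisible

universe u

/-- `G` is built from the trivial group by successive extensions by a nilpotent normal Hall
subgroup. The extensions are given by surjective homomorphisms, the Hall subgroup being the kernel,
so that no quotient of `G` has to be identified with the next group. -/
inductive HasNilpotentHallTower : ∀ (G : Type u) [Group G], Prop
  | of_subsingleton (G : Type u) [Group G] [Subsingleton G] : HasNilpotentHallTower G
  | of_surjective {G L : Type u} [Group G] [Group L] [Finite G] (f : G →* L)
      [Group.IsNilpotent f.ker] (hf : Function.Surjective f)
      (hL : (Nat.card f.ker).Coprime (Nat.card L)) (h : HasNilpotentHallTower L) :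
      HasNilpotentHallTower G

namespace HasNilpotentHallTower

theorem isCarterDivisible_of_injective {G : Type u} [Group G] (hG : HasNilpotentHallTower G)
    {K : Type u} [Group K] {j : K →* G} (hj : Function.Injective j) : IsCarterDivisible K := by
  induction hG generalizing K with
  | of_subsingleton G =>
    have := hj.subsingleton
    exact .of_subsingleton K
  | @of_surjective G L _ _ _ f _ _ hL _ ih =>
    have := Finite.of_injective j hj
    set φ := (f.comp j).rangeRestrict
    have hker : φ.ker = f.ker.comap j := by rw [MonoidHom.ker_rangeRestrict, MonoidHom.comap_ker]
    have hinj : Function.Injective (j.subgroupComap f.ker) := fun x y hxy =>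
      Subtype.ext (hj (congr_arg Subtype.val hxy))
    have : Group.IsNilpotent φ.ker := hker ▸ isNilpotent_of_injective hinj
    have hcop : (Nat.card φ.ker).Coprime (Nat.card (f.comp j).range) :=
      hL.of_dvd (hker ▸ card_comap_dvd_of_injective _ _ hj) (card_subgroup_dvd_card _)
    exact .of_surjective hcop (f.comp j).rangeRestrict_surjective (ih (subtype_injective _))
      fun W => ih (j := (f.comp j).range.subtype.comp W.subtype)
        ((subtype_injective _).comp W.subtype_injective)

theorem carterCount_dvd_index {G : Type u} [Group G] (hG : HasNilpotentHallTower G)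
    {C X : Subgroup G} (hC : IsCarterSubgroup C) (hX : X ≤ C) : carterCount X ∣ C.index :=
  (hG.isCarterDivisible_of_injective (j := MonoidHom.id G)
    Function.injective_id).carterCount_dvd_index C X hC hX

end HasNilpotentHallTower

namespace NormalSeries

variable {G : Type*} [Group G] (S : NormalSeries G)

/-- The canonical map `G ⧸ H i → G ⧸ H (i + 1)` between successive quotients of a normal series;
its kernel is a copy of the factor `H (i + 1) ⧸ H i`. -/
def quotientMap (i : ℕ) : G ⧸ S.term i →* G ⧸ S.term (i + 1) :=
  QuotientGroup.map _ _ (MonoidHom.id G) (S.mono i.le_succ)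

theorem quotientMap_surjective (i : ℕ) : Function.Surjective (S.quotientMap i) :=
  QuotientGroup.map_surjective_of_surjective _ _ _ (QuotientGroup.mk_surjective) _

theorem exists_factor_surjective_ker (i : ℕ) :
    ∃ φ : S.Factor i →* (S.quotientMap i).ker, Function.Surjective φ := by
  have hker : (S.quotientMap i).ker = (S.term (i + 1)).map (QuotientGroup.mk' (S.term i)) :=
    QuotientGroup.ker_map _ _ _ _
  rw [hker]
  have hle : (S.term i).subgroupOf (S.term (i + 1)) ≤
      ((QuotientGroup.mk' (S.term i)).subgroupMap (S.term (i + 1))).ker := fun x hx =>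
    Subtype.ext ((QuotientGroup.eq_one_iff _).2 hx)
  exact ⟨QuotientGroup.lift _ _ hle, QuotientGroup.lift_surjective_of_surjective _ _
    (MonoidHom.subgroupMap_surjective _ _) hle⟩

end NormalSeries

theorem index_dvd_index_of_natCard_dvd {G : Type*} [Group G] [Finite G] {H K : Subgroup G}
    (h : Nat.card H ∣ Nat.card K) : K.index ∣ H.index := by
  refine Nat.dvd_of_mul_dvd_mul_left (Nat.card_pos (α := H)) ?_
  rw [card_mul_index, ← card_mul_index K]
  exact mul_dvd_mul_right h _

namespace HasSylowTower

theorem hasNilpotentHallTower {G : Type u} [Group G] [Finite G] (h : HasSylowTower G) :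
    HasNilpotentHallTower G := by
  obtain ⟨S, hS⟩ := h
  suffices hquot : ∀ i ≤ S.length, HasNilpotentHallTower (G ⧸ S.term i) by
    have hker : (QuotientGroup.mk' (S.term 0)).ker = ⊥ := by
      rw [QuotientGroup.ker_mk', S.term_zero]
    have : Group.IsNilpotent (QuotientGroup.mk' (S.term 0)).ker := by
      rw [hker]
      infer_instance
    exact .of_surjective _ (QuotientGroup.mk'_surjective _)
      (by rw [hker, card_bot]; exact Nat.coprime_one_left _) (hquot 0 S.length.zero_le)
  intro i hi
  induction hi using Nat.decreasingInduction with
  | self =>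
    have : Subsingleton (G ⧸ S.term S.length) :=
      QuotientGroup.subsingleton_iff.2 S.term_length
    exact .of_subsingleton _
  | of_succ i hi ih =>
    obtain ⟨p, hp, P, ⟨e⟩⟩ := hS i hi
    have : Fact p.Prime := ⟨hp⟩
    obtain ⟨φ, hφ⟩ := S.exists_factor_surjective_ker i
    have : Group.IsNilpotent (S.Factor i) := (P.isPGroup'.of_equiv e.symm).isNilpotent
    have := Group.nilpotent_of_surjective φ hφ
    have hP : Nat.card P = Nat.card (S.Factor i) := (Nat.card_congr e.toEquiv).symm
    have hker : Nat.card (S.quotientMap i).ker ∣ Nat.card P := hP ▸ card_dvd_of_surjective φ hφ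
    have hindex : (S.term (i + 1)).index ∣ P.index :=
      index_dvd_index_of_natCard_dvd (hP ▸ card_quotient_dvd_card _)
    exact .of_surjective (S.quotientMap i) (S.quotientMap_surjective i)
      (P.card_coprime_index.of_dvd hker hindex) ih

end HasSylowTower

theorem characteristic_of_isCyclic {G : Type*} [Group G] [IsCyclic G] (H : Subgroup G) :
    H.Characteristic := by
  refine characteristic_iff_map_le.2 fun φ => ?_
  obtain ⟨m, hm⟩ := MonoidHom.map_cyclic φ.toMonoidHom
  rintro _ ⟨x, hx, rfl⟩
  exact hm x ▸ zpow_mem hx m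

theorem exists_normal_natCard_prime_of_isCyclic {G : Type*} [Group G] [Finite G]
    (N : Subgroup G) [N.Normal] [IsCyclic N] [Nontrivial N] :
    ∃ A : Subgroup G, A.Normal ∧ (Nat.card A).Prime := by
  obtain ⟨q, hq, hqN⟩ := Nat.exists_prime_and_dvd (Finite.one_lt_card (α := N)).ne'
  have : Fact q.Prime := ⟨hq⟩
  obtain ⟨y, hy⟩ := exists_prime_orderOf_dvd_card' q hqN
  have := characteristic_of_isCyclic (zpowers y)
  refine ⟨(zpowers y).map N.subtype, ConjAct.normal_of_characteristic_of_normal, ?_⟩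
  rwa [card_map_of_injective N.subtype_injective, Nat.card_zpowers, hy]

section Sylow

variable {G : Type*} [Group G] [Finite G] {p : ℕ} [Fact p.Prime]

theorem sylow_normal_of_index_dvd_prime {q : ℕ} (hq : q.Prime) (hqp : q < p) {P : Sylow p G}
    (hP : P.index ∣ q) : P.Normal := by
  have hone : Nat.card (Sylow p G) = 1 := by
    refine ((Nat.dvd_prime hq).1 (P.card_dvd_index.trans hP)).resolve_right fun h => ?_
    have hmod : q ≡ 1 [MOD p] := h ▸ card_sylow_modEq_one p G
    exact hq.ne_one (hmod.eq_of_lt_of_lt hqp (hq.one_lt.trans hqp))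
  have : Subsingleton (Sylow p G) := (Nat.card_eq_one_iff_unique.1 hone).1
  exact P.normal_of_subsingleton

theorem sylow_normal_of_normal_sup {A : Subgroup G} [A.Normal] (hA : (Nat.card A).Prime)
    (hAp : Nat.card A ≤ p) {P : Sylow p G} (hPA : ((P : Subgroup G) ⊔ A).Normal) : P.Normal := by
  rcases hAp.eq_or_lt with hAp | hAp
  · have hle : A ≤ P := (IsPGroup.of_card (n := 1) (by rw [hAp, pow_one])).le_sylow_of_normal P
    rwa [sup_eq_left.2 hle] at hPA
  · have hPK : (P : Subgroup G) ≤ (P : Subgroup G) ⊔ A := le_sup_left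
    have hindex : (P.subtype hPK).index ∣ Nat.card A := by
      change (P : Subgroup G).relIndex ((P : Subgroup G) ⊔ A) ∣ _
      rw [relIndex_sup_of_normal]
      exact relIndex_dvd_card _ _
    have := (P.subtype hPK).characteristic_of_normal
      (sylow_normal_of_index_dvd_prime hA hAp hindex)
    have hnormal := ConjAct.normal_of_characteristic_of_normal (H := (P : Subgroup G) ⊔ A)
      (K := (P.subtype hPK : Subgroup ↥((P : Subgroup G) ⊔ A)))
    rwa [Sylow.coe_subtype, map_subgroupOf_eq_of_le hPK] at hnormal

end Sylow

theorem NormalSeries.exists_term_eq_bot_and_ne_bot {G : Type*} [Group G] [Nontrivial G]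
    (S : NormalSeries G) : ∃ i < S.length, S.term i = ⊥ ∧ S.term (i + 1) ≠ ⊥ := by
  by_contra! h
  have hbot : ∀ i ≤ S.length, S.term i = ⊥ := fun i hi => by
    induction i with
    | zero => exact S.term_zero
    | succ i ih => exact h i hi (ih (i.le_succ.trans hi))
  exact bot_ne_top ((hbot _ le_rfl).symm.trans S.term_length)

namespace IsSupersoluble

theorem of_surjective {G H : Type*} [Group G] [Group H] (hG : IsSupersoluble G) {g : G →* H}
    (hg : Function.Surjective g) : IsSupersoluble H := by
  obtain ⟨S, hS⟩ := hG
  refine ⟨⟨S.length, fun i => (S.term i).map g, fun i j hij => map_mono (S.mono hij), ?_, ?_,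
    fun i => (S.normal i).map g hg⟩, fun i hi => ?_⟩
  · rw [S.term_zero, Subgroup.map_bot]
  · rw [S.term_length, map_top_of_surjective g hg]
  · have := hS i hi
    set B := S.term (i + 1)
    have := (S.normal i).map g hg
    let φ := (QuotientGroup.mk' (((S.term i).map g).subgroupOf (B.map g))).comp (g.subgroupMap B)
    have hφ : Function.Surjective φ :=
      (QuotientGroup.mk'_surjective _).comp (g.subgroupMap_surjective B)
    have hker : (S.term i).subgroupOf B ≤ φ.ker := fun x hx =>
      (QuotientGroup.eq_one_iff _).2 (mem_map_of_mem g hx)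
    exact isCyclic_of_surjective (QuotientGroup.lift _ φ hker)
      (QuotientGroup.lift_surjective_of_surjective _ φ hφ hker)

theorem exists_normal_natCard_prime {G : Type*} [Group G] [Finite G] [Nontrivial G]
    (hG : IsSupersoluble G) : ∃ A : Subgroup G, A.Normal ∧ (Nat.card A).Prime := by
  obtain ⟨S, hS⟩ := hG
  obtain ⟨i, hi, hbot, hne⟩ := S.exists_term_eq_bot_and_ne_bot
  have := hS i hi
  have hker : (S.term i).subgroupOf (S.term (i + 1)) ≤ (MonoidHom.id (S.term (i + 1))).ker := by
    rw [hbot, bot_subgroupOf]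
    exact bot_le
  have : IsCyclic (S.term (i + 1)) := isCyclic_of_surjective (QuotientGroup.lift _ _ hker)
    (QuotientGroup.lift_surjective_of_surjective _ _ Function.surjective_id hker)
  have : Nontrivial (S.term (i + 1)) := (nontrivial_iff_ne_bot _).2 hne
  exact exists_normal_natCard_prime_of_isCyclic (S.term (i + 1))

theorem sylow_normal {G : Type*} [Group G] [Finite G] (hG : IsSupersoluble G) {p : ℕ}
    [Fact p.Prime] (hmax : ∀ q : ℕ, q.Prime → q ∣ Nat.card G → q ≤ p) (P : Sylow p G) :
    P.Normal := by
  induction hn : Nat.card G using Nat.strong_induction_on generalizing G with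
  | _ n ih =>
  rcases subsingleton_or_nontrivial G with h | h
  · rw [Subsingleton.elim (P : Subgroup G) ⊥]
    infer_instance
  obtain ⟨A, hA, hAq⟩ := hG.exists_normal_natCard_prime
  have hlt : Nat.card (G ⧸ A) < n := by
    rw [← hn, card_eq_card_quotient_mul_card_subgroup A]
    exact lt_mul_of_one_lt_right Nat.card_pos hAq.one_lt
  have hmk := QuotientGroup.mk'_surjective A
  have hmap : ((P : Subgroup G).map (QuotientGroup.mk' A)).Normal := by
    rw [← Sylow.coe_mapSurjective hmk]
    exact ih _ hlt (hG.of_surjective hmk)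
      (fun r hr hrA => hmax r hr (hrA.trans (card_quotient_dvd_card A))) (P.mapSurjective hmk) rfl
  refine sylow_normal_of_normal_sup hAq (hmax _ hAq (card_subgroup_dvd_card A)) ?_
  rw [sup_comm, ← QuotientGroup.comap_map_mk']
  exact hmap.comap _

theorem exists_sylow_normal {G : Type*} [Group G] [Finite G] [Nontrivial G]
    (hG : IsSupersoluble G) :
    ∃ p : ℕ, p.Prime ∧ p ∣ Nat.card G ∧ ∃ P : Sylow p G, P.Normal := by
  obtain ⟨p, hp, hmax⟩ := (Nat.card G).primeFactors.exists_max_image id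
    (Nat.nonempty_primeFactors.2 Finite.one_lt_card)
  have hprime := Nat.prime_of_mem_primeFactors hp
  have : Fact p.Prime := ⟨hprime⟩
  exact ⟨p, hprime, Nat.dvd_of_mem_primeFactors hp, default, hG.sylow_normal (p := p)
    (fun q hq hqG => hmax q (Nat.mem_primeFactors.2 ⟨hq, hqG, Nat.card_pos.ne'⟩)) default⟩

theorem hasNilpotentHallTower {G : Type u} [Group G] [Finite G] (hG : IsSupersoluble G) :
    HasNilpotentHallTower G := by
  induction hn : Nat.card G using Nat.strong_induction_on generalizing G with
  | _ n ih =>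
  rcases subsingleton_or_nontrivial G with h | h
  · exact .of_subsingleton G
  obtain ⟨p, hp, hpG, P, hP⟩ := hG.exists_sylow_normal
  have : Fact p.Prime := ⟨hp⟩
  have hmk := QuotientGroup.mk'_surjective (P : Subgroup G)
  have hlt : Nat.card (G ⧸ (P : Subgroup G)) < n := by
    rw [← hn, card_eq_card_quotient_mul_card_subgroup (P : Subgroup G)]
    exact lt_mul_of_one_lt_right Nat.card_pos
      ((one_lt_card_iff_ne_bot _).2 (P.ne_bot_of_dvd_card hpG))
  have hker := QuotientGroup.ker_mk' (P : Subgroup G)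
  have : Group.IsNilpotent (QuotientGroup.mk' (P : Subgroup G)).ker :=
    hker.symm ▸ P.isPGroup'.isNilpotent
  exact .of_surjective _ hmk (hker.symm ▸ P.card_coprime_index)
    (ih _ hlt (hG.of_surjective hmk) rfl)

end IsSupersoluble

theorem mainTheorem6 (G : Type*) [Group G] [Finite G] :
    (HasSylowTower G →
      ∀ C : Subgroup G, IsCarterSubgroup C → ∀ X : Subgroup G, X ≤ C →
        carterCount X ∣ C.index) ∧
    (IsSupersoluble G →
      ∀ C : Subgroup G, IsCarterSubgroup C → ∀ X : Subgroup G, X ≤ C →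
        carterCount X ∣ C.index) :=
  ⟨fun h _ hC _ hX => h.hasNilpotentHallTower.carterCount_dvd_index hC hX,
    fun h _ hC _ hX => h.hasNilpotentHallTower.carterCount_dvd_index hC hX⟩
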